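/- For a rational number $a$ and an integer $n\ge 0$ let $(a)_n=a(a+1)\cdots(a+n-1)$ (with $(a)_0=1$) be the rising factorial. For rational numbers $x,y$ and a positive integer $m$, write $x\equiv y\pmod m$ if the numerator of $x-y$, written in lowest terms, is divisible by $m$. Let $p$ be a prime with $p\equiv 3\pmod 4$. Then $$\sum_{k=0}^{(p^2-1)/2}\frac{(\frac12)_k^3}{k!^3}\equiv p^2\,\frac{(\frac34)_{(p^2-1)/2}}{(\frac54)_{(p^2-1)/2}}\pmod{p^4}$$ and $$\sum_{k=0}^{p^2-1}\frac{(\frac12)_k^3}{k!^3}\equiv p^2\,\frac{(\frac34)_{(p^2-1)/2}}{(\frac54)_{(p^2-1)/2}}\pmod{p^4}.$$ -/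

import Mathlib

/-- Congruence of rational numbers modulo a natural number `m`: written in lowest terms, the
difference `a - b` has a numerator divisible by `m` (so its denominator is coprime to `m`).
For `m = p ^ e` with `p` prime this says `a - b ∈ p ^ e ℤ_(p)`. -/
def RatModEq (m : ℕ) (a b : ℚ) : Prop :=
  (m : ℤ) ∣ (a - b).num

/-- The rising factorial `(a)_n = a (a + 1) ⋯ (a + n - 1)` of a rational number. -/
noncomputable def risingFactorial (a : ℚ) (n : ℕ) : ℚ :=
  (ascPochhammer ℚ n).eval a

/-!
Write `c k = (1/2)_k / k!`. Dixon's sum for the well-poised `₃F₂` with parameters `1/2`,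
`(1 + w)/2`, `(1 - w)/2` terminates for odd `w`; at `w = p ^ 2` it has the value
`p ^ 2 (3/4)_N / (5/4)_N` with `N = (p ^ 2 - 1) / 2`, while its summand is `c k ^ 3` times a product
of factors `(1 - (w / (2j + 1)) ^ 2) / (1 - (w / (2j + 2)) ^ 2)`, hence congruent to `c k ^ 3`
modulo `p ^ 2`. To reach `p ^ 4`, write `k = a p + b` with `b < p`. For `b > (p - 1) / 2` the term
`c k` is divisible by `p`. For `b ≤ (p - 1) / 2` the product of factors depends only on `a` modulo
`p ^ 4`, so it remains to see that the sum of `c (a p + b) ^ 3` over this half block vanishes modulo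
`p ^ 2`. Now `c (a p + b) = c (a p) * h (2 a p) b`, where
`h w b = ((1 + w) / 2)_b / (1 + w / 2)_b`, and for `w ∈ p ℤ_(p)` the sum of `h w b ^ 3` is an affine
function of `w` modulo `p ^ 2`. It vanishes at `w = 0`, by Dixon's sum at `w = p`, whose value
`p ∏ (4j + 3) / (4j + 5)` has a second factor `p` because `p ≡ 3 (mod 4)`; and it vanishes at
`w = -p`, since reversing the order of summation turns it into a multiple of the sum at `w = 0`.
The terms with `k > N` are small for the same reasons.
-/

section HalfRatio

variable {K : Type*} [Field K]

/-- The quotient `((1 + w) / 2)_k / (1 + w / 2)_k` of rising factorials, written with the powers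
of `2` cleared. At `w = 0` it is `(1 / 2)_k / k!`. -/
def halfRatio (w : K) (k : ℕ) : K :=
  ∏ j ∈ Finset.range k, (2 * j + 1 + w) / (2 * j + 2 + w)

theorem halfRatio_succ (w : K) (k : ℕ) :
    halfRatio w (k + 1) = halfRatio w k * ((2 * k + 1 + w) / (2 * k + 2 + w)) :=
  Finset.prod_range_succ ..

theorem halfRatio_add (w : K) (k l : ℕ) :
    halfRatio w (k + l) = halfRatio w k * halfRatio (w + 2 * k) l := by
  rw [halfRatio, Finset.prod_range_add]
  congr 1
  refine Finset.prod_congr rfl fun j _ => ?_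
  push_cast
  congr 1 <;> ring

theorem halfRatio_zero_add (k l : ℕ) :
    halfRatio (0 : K) (k + l) = halfRatio (0 : K) k * halfRatio (2 * k : K) l := by
  rw [halfRatio_add, zero_add]

theorem halfRatio_succ' (w : K) (k : ℕ) :
    halfRatio w (k + 1) = (1 + w) / (2 + w) * halfRatio (w + 2) k := by
  rw [add_comm k, halfRatio_add]
  simp [halfRatio]

theorem halfRatio_eq_zero {w : K} {j k : ℕ} (hjk : j < k) (hw : 2 * j + 1 + w = 0) :
    halfRatio w k = 0 :=
  Finset.prod_eq_zero (Finset.mem_range.2 hjk) (by rw [hw, zero_div])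

variable [CharZero K]

theorem halfRatio_neg_mul_halfRatio_zero (m : ℕ) :
    halfRatio (-(2 * m + 1 : K)) m * halfRatio 0 m = 1 := by
  rw [halfRatio, ← Finset.prod_range_reflect, halfRatio, ← Finset.prod_mul_distrib]
  refine Finset.prod_eq_one fun j hj => ?_
  have hcast : ((m - 1 - j : ℕ) : K) = m - 1 - j := by
    rw [Finset.mem_range] at hj
    rw [Nat.cast_sub (by omega), Nat.cast_sub (by omega), Nat.cast_one]
  have hodd : (2 * j + 1 : K) ≠ 0 := by exact_mod_cast (2 * j).succ_ne_zero
  have heven : (2 * j + 2 : K) ≠ 0 := by exact_mod_cast (2 * j + 1).succ_ne_zero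
  rw [hcast, add_zero, add_zero, show 2 * (m - 1 - j) + 1 + -(2 * m + 1 : K) = -(2 * j + 2) by ring,
    show 2 * (m - 1 - j) + 2 + -(2 * m + 1 : K) = -(2 * j + 1) by ring, neg_div_neg_eq,
    div_mul_div_cancel₀ hodd, div_self heven]

theorem halfRatio_neg_reflect {b m : ℕ} (hb : b ≤ m) :
    halfRatio (-(2 * m + 1 : K)) b = halfRatio (-(2 * m + 1 : K)) m * halfRatio 0 (m - b) := by
  obtain ⟨c, rfl⟩ := Nat.exists_eq_add_of_le hb
  rw [Nat.add_sub_cancel_left, halfRatio_add, mul_assoc,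
    show -(2 * ((b + c : ℕ) : K) + 1) + 2 * b = -(2 * c + 1) by push_cast; ring,
    halfRatio_neg_mul_halfRatio_zero, mul_one]

theorem sum_halfRatio_neg_pow (m n : ℕ) :
    ∑ b ∈ Finset.range (m + 1), halfRatio (-(2 * m + 1 : K)) b ^ n =
      halfRatio (-(2 * m + 1 : K)) m ^ n * ∑ b ∈ Finset.range (m + 1), halfRatio 0 b ^ n := by
  rw [← Finset.sum_range_reflect (fun b => halfRatio 0 b ^ n), Finset.mul_sum]
  refine Finset.sum_congr rfl fun b hb => ?_
  rw [← mul_pow, Nat.add_sub_cancel,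
    ← halfRatio_neg_reflect (Nat.lt_succ_iff.1 (Finset.mem_range.1 hb))]

theorem halfRatio_zero_eq_centralBinom_div (k : ℕ) :
    halfRatio 0 k = (k.centralBinom : K) / 4 ^ k := by
  induction k with
  | zero => simp [halfRatio]
  | succ k ih =>
    have hrec : (k + 1 : K) * (k + 1).centralBinom = 2 * (2 * k + 1) * k.centralBinom := by
      exact_mod_cast Nat.succ_mul_centralBinom_succ k
    have hk : (k + 1 : K) ≠ 0 := by exact_mod_cast k.succ_ne_zero
    have heven : (2 * k + 2 : K) = 2 * (k + 1) := by ring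
    rw [halfRatio_succ, ih, add_zero, add_zero, heven, div_mul_div_comm,
      div_eq_div_iff (by simp [hk]) (by simp)]
    linear_combination -2 * 4 ^ k * hrec

end HalfRatio

section Dixon

variable {K : Type*} [Field K]

/-- The summand of the well-poised series `₃F₂(1/2, (1 + w)/2, (1 - w)/2; 1 + w/2, 1 - w/2; 1)`. -/
def dixonTerm (w : K) (k : ℕ) : K :=
  halfRatio 0 k * halfRatio w k * halfRatio (-w) k

theorem dixonTerm_succ (w : K) (k : ℕ) :
    dixonTerm w (k + 1) = dixonTerm w k * ((2 * k + 1) * (2 * k + 1 + w) * (2 * k + 1 - w) /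
      ((2 * k + 2) * (2 * k + 2 + w) * (2 * k + 2 - w))) := by
  simp only [dixonTerm, halfRatio_succ, add_zero, ← sub_eq_add_neg, div_eq_mul_inv, mul_inv]
  ring

theorem dixonTerm_add_two_succ {w : K} (hw : w ≠ 0) (hw₁ : w + 1 ≠ 0) (hw₂ : w + 2 ≠ 0) (k : ℕ) :
    dixonTerm (w + 2) (k + 1) = dixonTerm w k * ((w + 2) / w *
      ((2 * k + 1) * (2 * k + 1 + w) * (2 * k + 3 + w) /
        ((2 * k + 2) * (2 * k + 2 + w) * (2 * k + 4 + w)))) := by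
  have hpos : halfRatio (w + 2) (k + 1) = (w + 2) / (w + 1) * halfRatio w (k + 2) := by
    rw [show k + 2 = k + 1 + 1 from rfl, halfRatio_succ' w, add_comm 1, add_comm 2]
    field_simp
  have hneg : halfRatio (-(w + 2)) (k + 1) = (w + 1) / w * halfRatio (-w) k := by
    rw [halfRatio_succ', show 1 + -(w + 2) = -(w + 1) by ring, show 2 + -(w + 2) = -w by ring,
      show -(w + 2) + 2 = -w by ring, neg_div_neg_eq]
  have hcancel : (w + 2) / (w + 1) * ((w + 1) / w) = (w + 2) / w := by field_simp
  simp only [dixonTerm, hpos, hneg, ← hcancel, halfRatio_succ, Nat.cast_add, Nat.cast_one,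
    add_zero, div_eq_mul_inv, mul_inv]
  ring_nf

variable [CharZero K]

/-- The right-hand side is the Wilf–Zeilberger certificate of Dixon's sum for the shift
`w ↦ w + 2`. -/
theorem sum_dixonTerm_add_two_sub {w : K} (hw₁ : w + 1 ≠ 0) (heven : ∀ j : ℤ, w ≠ 2 * j) (n : ℕ) :
    w * (2 * w + 3) * ∑ k ∈ Finset.range (n + 1), dixonTerm (w + 2) k -
      (w + 2) * (2 * w + 1) * ∑ k ∈ Finset.range (n + 1), dixonTerm w k =
    -(2 * (w + 2) * ((2 * n + 1) * (2 * n + 1 + w) / (2 * n + 2 + w)) * dixonTerm w n) := by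
  have hw : w ≠ 0 := by simpa using heven 0
  have hw₂ : w + 2 ≠ 0 := fun h => heven (-1) (by push_cast; linear_combination h)
  induction n with
  | zero =>
    rw [Finset.sum_range_one, Finset.sum_range_one]
    simp only [dixonTerm, halfRatio, Finset.range_zero, Finset.prod_empty, Nat.cast_zero]
    rw [show (2 * 0 + 2 + w : K) = w + 2 by ring]
    field_simp
    ring
  | succ n ih =>
    have hn : (n + 1 : K) ≠ 0 := by exact_mod_cast n.succ_ne_zero
    have hadd : (2 * (n + 1) + w : K) ≠ 0 := fun h =>
      heven (-(n + 1)) (by push_cast; linear_combination h)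
    have hadd' : (2 * n + 4 + w : K) ≠ 0 := fun h =>
      heven (-(n + 2)) (by push_cast; linear_combination h)
    have hsub : (2 * (n + 1) - w : K) ≠ 0 := fun h =>
      heven (n + 1) (by push_cast; linear_combination -h)
    rw [Finset.sum_range_succ, Finset.sum_range_succ _ (n + 1), mul_add _ _ (dixonTerm _ (n + 1)),
      mul_add _ _ (dixonTerm _ (n + 1)), add_sub_add_comm, ih,
      dixonTerm_add_two_succ hw hw₁ hw₂, dixonTerm_succ, Nat.cast_succ,
      show (2 * (n + 1) + 2 + w : K) = 2 * n + 4 + w by ring]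
    field_simp
    ring

theorem sum_dixonTerm_odd (N : ℕ) :
    ∑ k ∈ Finset.range (N + 1), dixonTerm (2 * N + 1 : K) k =
      (2 * N + 1) * ∏ j ∈ Finset.range N, ((4 * j + 3) / (4 * j + 5) : K) := by
  induction N with
  | zero => simp [dixonTerm, halfRatio]
  | succ N ih =>
    have hvanish : dixonTerm (2 * N + 1 : K) (N + 1) = 0 := by
      rw [dixonTerm, halfRatio_eq_zero (w := -(2 * N + 1 : K)) N.lt_succ_self (by ring), mul_zero]
    have hrec := sum_dixonTerm_add_two_sub (w := (2 * N + 1 : K))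
      (by exact_mod_cast (2 * N + 1).succ_ne_zero)
      (fun j h => by have : (2 * N + 1 : ℤ) = 2 * j := by exact_mod_cast h
                     omega) (N + 1)
    have hw : (2 * N + 1 : K) ≠ 0 := by exact_mod_cast (2 * N).succ_ne_zero
    have h5 : (4 * N + 5 : K) ≠ 0 := by exact_mod_cast (4 * N + 4).succ_ne_zero
    rw [hvanish, mul_zero, neg_zero, sub_eq_zero, Finset.sum_range_succ (dixonTerm (2 * N + 1 : K)),
      hvanish, add_zero, ih] at hrec
    rw [Finset.prod_range_succ, show (2 * ((N + 1 : ℕ) : K) + 1) = 2 * N + 1 + 2 by push_cast; ring]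
    apply mul_left_cancel₀ (mul_ne_zero hw h5)
    have hdiv : (4 * N + 5 : K) * ((4 * N + 3) / (4 * N + 5)) = 4 * N + 3 := mul_div_cancel₀ _ h5
    linear_combination hrec - (2 * N + 1) * (2 * N + 1 + 2) *
      (∏ j ∈ Finset.range N, ((4 * j + 3) / (4 * j + 5) : K)) * hdiv

/-- The factor relating the summand of Dixon's series at `w` to its value `halfRatio 0 k ^ 3`
at `w = 0`. -/
def dixonCorrection (w : K) (k : ℕ) : K :=
  ∏ j ∈ Finset.range k, (1 - (w / (2 * j + 1)) ^ 2) / (1 - (w / (2 * j + 2)) ^ 2)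

theorem dixonTerm_eq_cube_mul_dixonCorrection (w : K) (k : ℕ) :
    dixonTerm w k = halfRatio 0 k ^ 3 * dixonCorrection w k := by
  rw [pow_succ', mul_assoc, dixonTerm, mul_assoc]
  congr 1
  simp only [halfRatio, dixonCorrection, ← Finset.prod_mul_distrib, ← Finset.prod_pow]
  refine Finset.prod_congr rfl fun j _ => ?_
  have hodd : (2 * j + 1 : K) ≠ 0 := by exact_mod_cast (2 * j).succ_ne_zero
  have heven : (2 * j + 2 : K) ≠ 0 := by exact_mod_cast (2 * j + 1).succ_ne_zero
  have hquot : ∀ n : K, n ≠ 0 → 1 - (w / n) ^ 2 = (n + w) * (n + -w) / n ^ 2 := fun n hn => by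
    field_simp
    ring
  rw [hquot _ hodd, hquot _ heven, div_div_div_eq, div_mul_div_comm]
  simp only [add_zero]
  field_simp

end Dixon

theorem sum_range_mul_mem_of_blocks {M S : Type*} [AddCommMonoid M] [SetLike S M]
    [AddSubmonoidClass S M] {s : S} {g : ℕ → M} {k l n : ℕ} (hl : l ≤ n)
    (hlower : ∀ a < k, ∑ b ∈ Finset.range l, g (a * n + b) ∈ s)
    (hupper : ∀ a < k, ∀ b, l ≤ b → b < n → g (a * n + b) ∈ s) :
    ∑ i ∈ Finset.range (k * n), g i ∈ s := by
  induction k with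
  | zero => simp
  | succ k ih =>
    rw [Nat.succ_mul, Finset.sum_range_add, ← Finset.sum_range_add_sum_Ico _ hl]
    refine add_mem (ih (fun a ha => hlower a (by omega)) fun a ha => hupper a (by omega))
      (add_mem (hlower k (by omega)) (sum_mem fun b hb => ?_))
    rw [Finset.mem_Ico] at hb
    exact hupper k (by omega) b hb.1 hb.2

theorem two_mul_mul_lt_sq {a n : ℕ} (h : 2 * a < n) : 2 * (a * n) < n ^ 2 := by
  rw [sq, ← mul_assoc]
  exact Nat.mul_lt_mul_of_pos_right h (by omega)

/-- The fractional ideal `p ^ e ℤ_(p)` of `ℚ`, in terms of which congruences modulo `p ^ e` are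
stated. -/
def padicIdeal (p : ℕ) [Fact p.Prime] (e : ℕ) : AddSubgroup ℚ where
  carrier := {x | padicNorm p x ≤ (p : ℚ) ^ (-(e : ℤ))}
  zero_mem' := by
    rw [Set.mem_ofPred_eq, padicNorm.zero]
    positivity
  add_mem' hx hy := padicNorm.nonarchimedean.trans (max_le hx hy)
  neg_mem' hx := by rwa [Set.mem_ofPred_eq, padicNorm.neg]

namespace padicIdeal

variable {p : ℕ} [Fact p.Prime] {e f : ℕ} {x y u : ℚ}

theorem mem_iff : x ∈ padicIdeal p e ↔ padicNorm p x ≤ (p : ℚ) ^ (-(e : ℤ)) :=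
  Iff.rfl

theorem mem_zero_of_norm_eq_one (h : padicNorm p x = 1) : x ∈ padicIdeal p 0 := by
  simp [mem_iff, h]

theorem mul_mem_iff (hu : padicNorm p u = (p : ℚ) ^ (-(f : ℤ))) :
    u * x ∈ padicIdeal p (f + e) ↔ x ∈ padicIdeal p e := by
  have hp : (0 : ℚ) < p := by exact_mod_cast (Fact.out : p.Prime).pos
  rw [mem_iff, mem_iff, padicNorm.mul, hu, Nat.cast_add, neg_add, zpow_add₀ hp.ne',
    mul_le_mul_iff_right₀ (by positivity)]

protected theorem mul_mem (hx : x ∈ padicIdeal p e) (hy : y ∈ padicIdeal p f) :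
    x * y ∈ padicIdeal p (e + f) := by
  have hp : (p : ℚ) ≠ 0 := by exact_mod_cast (Fact.out : p.Prime).ne_zero
  rw [mem_iff, padicNorm.mul, Nat.cast_add, neg_add, zpow_add₀ hp]
  exact mul_le_mul hx hy (padicNorm.nonneg _) (by positivity)

instance : SetLike.GradedMonoid (padicIdeal p) where
  one_mem := mem_zero_of_norm_eq_one padicNorm.one
  mul_mem _ _ _ _ := padicIdeal.mul_mem

protected theorem pow_mem (hx : x ∈ padicIdeal p e) (n : ℕ) : x ^ n ∈ padicIdeal p (n * e) :=
  SetLike.pow_mem_graded n hx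

theorem antitone : Antitone (padicIdeal p) := fun _ _ h _ hx =>
  (mem_iff.1 hx).trans (zpow_le_zpow_right₀
    (by exact_mod_cast (Fact.out : p.Prime).one_le) (by simpa using h))

theorem mul_mem_left (hx : x ∈ padicIdeal p 0) (hy : y ∈ padicIdeal p e) :
    x * y ∈ padicIdeal p e := by
  simpa using padicIdeal.mul_mem hx hy

theorem mul_mem_right (hx : x ∈ padicIdeal p e) (hy : y ∈ padicIdeal p 0) :
    x * y ∈ padicIdeal p e := by
  simpa using padicIdeal.mul_mem hx hy

protected theorem prod_mem {ι : Type*} {s : Finset ι} {g : ι → ℚ}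
    (h : ∀ i ∈ s, g i ∈ padicIdeal p 0) : ∏ i ∈ s, g i ∈ padicIdeal p 0 := by
  simpa using SetLike.prod_mem_graded (padicIdeal p) (fun _ => 0) g h

theorem natCast_mem (n : ℕ) : (n : ℚ) ∈ padicIdeal p 0 :=
  SetLike.natCast_mem_graded _ n

theorem natCast_mem_of_dvd {n : ℕ} (h : p ∣ n) : (n : ℚ) ∈ padicIdeal p 1 := by
  have := (padicNorm.dvd_iff_norm_le (p := p) (n := 1) (z := n)).1
    (by exact_mod_cast (pow_one p).symm ▸ h)
  exact_mod_cast this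

theorem self_mem : (p : ℚ) ∈ padicIdeal p 1 :=
  natCast_mem_of_dvd dvd_rfl

theorem self_pow_mem : (p : ℚ) ^ e ∈ padicIdeal p e := by
  simpa using padicIdeal.pow_mem (self_mem (p := p)) e

protected theorem div_mem (hx : x ∈ padicIdeal p e) (hu : padicNorm p u = 1) :
    x / u ∈ padicIdeal p e := by
  rwa [mem_iff, padicNorm.div, hu, div_one]

theorem norm_add_eq_one (hu : padicNorm p u = 1) (hx : x ∈ padicIdeal p 1) :
    padicNorm p (u + x) = 1 := by
  have hlt : padicNorm p x < 1 := by
    refine lt_of_le_of_lt hx ?_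
    rw [Nat.cast_one, zpow_neg_one]
    exact inv_lt_one_of_one_lt₀ (by exact_mod_cast (Fact.out : p.Prime).one_lt)
  rw [padicNorm.add_eq_max_of_ne (hu.trans_ne hlt.ne'), hu, max_eq_left hlt.le]

theorem ratModEq_of_sub_mem (h : x - y ∈ padicIdeal p e) : RatModEq (p ^ e) x y := by
  rw [RatModEq, padicNorm.dvd_iff_norm_le, ← Rat.mul_den_eq_num]
  exact mul_mem_right h (natCast_mem _)

theorem mul_sub_one_mem (hx : x - 1 ∈ padicIdeal p e) (hy : y - 1 ∈ padicIdeal p e) :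
    x * y - 1 ∈ padicIdeal p e := by
  rw [show x * y - 1 = (x - 1) * (y - 1) + (x - 1) + (y - 1) by ring]
  exact add_mem (add_mem (antitone (Nat.le_add_right e e) (padicIdeal.mul_mem hx hy)) hx) hy

theorem prod_sub_one_mem {ι : Type*} {s : Finset ι} {g : ι → ℚ}
    (h : ∀ i ∈ s, g i - 1 ∈ padicIdeal p e) : ∏ i ∈ s, g i - 1 ∈ padicIdeal p e :=
  Finset.prod_induction g (· - 1 ∈ padicIdeal p e) (fun _ _ => mul_sub_one_mem) (by simp) h

theorem one_sub_div_one_sub_sub_one_mem (he : e ≠ 0) (hx : x ∈ padicIdeal p e)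
    (hy : y ∈ padicIdeal p e) : (1 - x) / (1 - y) - 1 ∈ padicIdeal p e := by
  have hunit : padicNorm p (1 - y) = 1 := by
    rw [sub_eq_add_neg]
    exact norm_add_eq_one padicNorm.one (neg_mem (antitone (Nat.one_le_iff_ne_zero.2 he) hy))
  have hne : 1 - y ≠ 0 := fun h => by simp [h] at hunit
  rw [div_sub_one hne, sub_sub_sub_cancel_left]
  exact padicIdeal.div_mem (sub_mem hy hx) hunit

theorem pow_div_natCast_mem {n r : ℕ} (hn : 0 < n) (hlt : n < p ^ r) :
    (p : ℚ) ^ r / n ∈ padicIdeal p 1 := by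
  have hp : p.Prime := Fact.out
  obtain ⟨s, u, hu, rfl⟩ := Nat.exists_eq_pow_mul_and_not_dvd hn.ne' p hp.ne_one
  have hsr : s < r := (Nat.pow_lt_pow_iff_right hp.one_lt).1 <|
    (Nat.le_mul_of_pos_right _ (Nat.pos_of_mul_pos_left hn)).trans_lt hlt
  have hp₀ : (p : ℚ) ≠ 0 := by exact_mod_cast hp.ne_zero
  have hcancel : (p : ℚ) ^ r / (p ^ s * u : ℕ) = p ^ (r - s) / u := by
    rw [← Nat.sub_add_cancel hsr.le, pow_add, Nat.cast_mul, Nat.cast_pow, mul_comm,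
      mul_div_mul_left _ _ (pow_ne_zero s hp₀), Nat.add_sub_cancel]
  rw [hcancel]
  exact padicIdeal.div_mem (antitone (Nat.sub_pos_of_lt hsr) self_pow_mem)
    ((padicNorm.nat_eq_one_iff u).2 hu)

end padicIdeal

/-- The ring of functions that agree modulo `p ^ 2` on `p ℤ_(p)` with an affine function having
coefficients in `ℤ_(p)`. -/
def affineModSq (p : ℕ) [Fact p.Prime] : Subring (ℚ → ℚ) where
  carrier := {f | ∃ c ∈ padicIdeal p 0, ∃ d ∈ padicIdeal p 0, ∀ w ∈ padicIdeal p 1,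
    f w - (c + w * d) ∈ padicIdeal p 2}
  zero_mem' := ⟨0, zero_mem _, 0, zero_mem _, fun w _ => by simp⟩
  one_mem' := ⟨1, SetLike.one_mem_graded _, 0, zero_mem _, fun w _ => by simp⟩
  neg_mem' := by
    rintro f ⟨c, hc, d, hd, hf⟩
    refine ⟨-c, neg_mem hc, -d, neg_mem hd, fun w hw => ?_⟩
    convert neg_mem (hf w hw) using 1
    rw [Pi.neg_apply]
    ring
  add_mem' := by
    rintro f g ⟨c, hc, d, hd, hf⟩ ⟨c', hc', d', hd', hg⟩
    refine ⟨c + c', add_mem hc hc', d + d', add_mem hd hd', fun w hw => ?_⟩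
    convert add_mem (hf w hw) (hg w hw) using 1
    rw [Pi.add_apply]
    ring
  mul_mem' := by
    rintro f g ⟨c, hc, d, hd, hf⟩ ⟨c', hc', d', hd', hg⟩
    refine ⟨c * c', padicIdeal.mul_mem_left hc hc', c * d' + d * c',
      add_mem (padicIdeal.mul_mem_left hc hd') (padicIdeal.mul_mem_left hd hc'), fun w hw => ?_⟩
    have hw₀ : w ∈ padicIdeal p 0 := padicIdeal.antitone zero_le_one hw
    have hf₀ : c + w * d ∈ padicIdeal p 0 := add_mem hc (padicIdeal.mul_mem_left hw₀ hd)
    have hg₀ : g w ∈ padicIdeal p 0 := by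
      rw [← sub_add_cancel (g w) (c' + w * d')]
      exact add_mem (padicIdeal.antitone zero_le_two (hg w hw))
        (add_mem hc' (padicIdeal.mul_mem_left hw₀ hd'))
    have hww : w * w ∈ padicIdeal p (1 + 1) := padicIdeal.mul_mem hw hw
    have hsplit : f w * g w - (c * c' + w * (c * d' + d * c')) = (f w - (c + w * d)) * g w +
        (c + w * d) * (g w - (c' + w * d')) + w * w * (d * d') := by ring
    rw [Pi.mul_apply, hsplit]
    exact add_mem (add_mem (padicIdeal.mul_mem_right (hf w hw) hg₀)
      (padicIdeal.mul_mem_left hf₀ (hg w hw)))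
      (padicIdeal.mul_mem_right hww (padicIdeal.mul_mem_left hd hd'))

namespace affineModSq

variable {p : ℕ} [Fact p.Prime]

theorem add_div_add_mem {c u : ℚ} (hc : c ∈ padicIdeal p 0) (hu : padicNorm p u = 1) :
    (fun w => (c + w) / (u + w)) ∈ affineModSq p := by
  have hu₀ : u ∈ padicIdeal p 0 := padicIdeal.mem_zero_of_norm_eq_one hu
  refine ⟨c / u, padicIdeal.div_mem hc hu, (u - c) / u / u,
    padicIdeal.div_mem (padicIdeal.div_mem (sub_mem hu₀ hc) hu) hu, fun w hw => ?_⟩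
  have huw : padicNorm p (u + w) = 1 := padicIdeal.norm_add_eq_one hu hw
  have hne : u ≠ 0 := by rintro rfl; simp at hu
  have hne' : u + w ≠ 0 := fun h => by simp [h] at huw
  have hww : w * w ∈ padicIdeal p (1 + 1) := padicIdeal.mul_mem hw hw
  have hquad : w * w * (c - u) / u / u / (u + w) ∈ padicIdeal p 2 :=
    padicIdeal.div_mem (padicIdeal.div_mem (padicIdeal.div_mem (padicIdeal.mul_mem_right
      hww (sub_mem hc hu₀)) hu) hu) huw
  convert hquad using 1
  field_simp
  ring

theorem apply_mem {f : ℚ → ℚ} (hf : f ∈ affineModSq p) {w₀ : ℚ}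
    (hw₀ : padicNorm p w₀ = (p : ℚ) ^ (-((1 : ℕ) : ℤ))) (hzero : f 0 ∈ padicIdeal p 2)
    (hroot : f w₀ ∈ padicIdeal p 2) {w : ℚ} (hw : w ∈ padicIdeal p 1) : f w ∈ padicIdeal p 2 := by
  obtain ⟨c, -, d, -, hf⟩ := hf
  have hc : c ∈ padicIdeal p 2 := by
    convert sub_mem hzero (hf 0 (zero_mem _)) using 1
    ring
  have hd : d ∈ padicIdeal p 1 := by
    refine (padicIdeal.mul_mem_iff hw₀).1 ?_
    convert sub_mem (sub_mem hroot (hf w₀ hw₀.le)) hc using 1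
    ring
  have hwd : w * d ∈ padicIdeal p (1 + 1) := padicIdeal.mul_mem hw hd
  convert add_mem (hf w hw) (add_mem hc hwd) using 1
  ring

end affineModSq

section Residue

variable {p : ℕ} [Fact p.Prime] {m : ℕ}

theorem padicNorm_two_mul_add_two (hp2 : p ≠ 2) {j : ℕ} (hj : j + 1 < p) :
    padicNorm p (2 * j + 2) = 1 := by
  have hp : p.Prime := Fact.out
  have hnot : ¬p ∣ 2 * (j + 1) := fun h => (hp.dvd_mul.1 h).elim
    (fun h => hp2 ((Nat.prime_dvd_prime_iff_eq hp Nat.prime_two).1 h))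
    (Nat.not_dvd_of_pos_of_lt j.succ_pos hj)
  exact_mod_cast (padicNorm.nat_eq_one_iff (p := p) (2 * (j + 1))).2 hnot

theorem padicNorm_two_mul_add_one {j : ℕ} (hj : 2 * j + 1 < p) : padicNorm p (2 * j + 1) = 1 := by
  exact_mod_cast (padicNorm.nat_eq_one_iff (p := p) (2 * j + 1)).2
    (Nat.not_dvd_of_pos_of_lt (2 * j).succ_pos hj)

theorem two_mul_add_one_mem (j : ℕ) : (2 * j + 1 : ℚ) ∈ padicIdeal p 0 := by
  exact_mod_cast padicIdeal.natCast_mem (p := p) (2 * j + 1)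

theorem halfRatio_factor_mem (hp2 : p ≠ 2) {w : ℚ} (hw : w ∈ padicIdeal p 1) {j : ℕ}
    (hj : j + 1 < p) : (2 * j + 1 + w) / (2 * j + 2 + w) ∈ padicIdeal p 0 :=
  padicIdeal.div_mem (add_mem (two_mul_add_one_mem j) (padicIdeal.antitone zero_le_one hw))
    (padicIdeal.norm_add_eq_one (padicNorm_two_mul_add_two hp2 hj) hw)

theorem halfRatio_mem (hp2 : p ≠ 2) {w : ℚ} (hw : w ∈ padicIdeal p 1) {b : ℕ}
    (hb : b < p) : halfRatio w b ∈ padicIdeal p 0 :=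
  padicIdeal.prod_mem fun _ hj =>
    halfRatio_factor_mem hp2 hw (Nat.succ_le_of_lt (Finset.mem_range.1 hj) |>.trans_lt hb)

theorem halfRatio_mem_of_add_mem (hm : p = 2 * m + 1) {w : ℚ} (hw : w ∈ padicIdeal p 1) {e : ℕ}
    (hpw : p + w ∈ padicIdeal p e) {b : ℕ} (hmb : m < b) (hb : b < p) :
    halfRatio w b ∈ padicIdeal p e := by
  rw [halfRatio, ← Finset.mul_prod_erase _ _ (Finset.mem_range.2 hmb)]
  have hpm : (2 * m + 1 : ℚ) = p := by exact_mod_cast hm.symm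
  refine padicIdeal.mul_mem_right (padicIdeal.div_mem (by rwa [hpm])
    (padicIdeal.norm_add_eq_one (padicNorm_two_mul_add_two (by omega) (by omega)) hw))
    (padicIdeal.prod_mem fun j hj => halfRatio_factor_mem (by omega) hw ?_)
  have := Finset.mem_range.1 (Finset.mem_of_mem_erase hj)
  omega

theorem halfRatio_mem_affineModSq (hp2 : p ≠ 2) {b : ℕ} (hb : b < p) :
    (halfRatio · b) ∈ affineModSq p := by
  have hprod : (halfRatio · b) =
      ∏ j ∈ Finset.range b, fun w : ℚ => (2 * j + 1 + w) / (2 * j + 2 + w) := by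
    ext w
    rw [Finset.prod_apply, halfRatio]
  rw [hprod]
  refine prod_mem fun j hj => affineModSq.add_div_add_mem (two_mul_add_one_mem j)
    (padicNorm_two_mul_add_two hp2 ?_)
  have := Finset.mem_range.1 hj
  omega

theorem sq_pow_div_natCast_mem {n r : ℕ} (hn : 0 < n) (hlt : n < p ^ r) :
    ((p : ℚ) ^ r / n) ^ 2 ∈ padicIdeal p 2 :=
  padicIdeal.pow_mem (e := 1) (padicIdeal.pow_div_natCast_mem hn hlt) 2

theorem dixonCorrection_prime_pow_sub_one_mem {k r : ℕ} (hk : 2 * k < p ^ r) :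
    dixonCorrection ((p : ℚ) ^ r) k - 1 ∈ padicIdeal p 2 := by
  refine padicIdeal.prod_sub_one_mem fun j hj => ?_
  rw [Finset.mem_range] at hj
  refine padicIdeal.one_sub_div_one_sub_sub_one_mem two_ne_zero ?_ ?_
  · exact_mod_cast sq_pow_div_natCast_mem (p := p) (n := 2 * j + 1) (by omega) (by omega)
  · exact_mod_cast sq_pow_div_natCast_mem (p := p) (n := 2 * j + 2) (by omega) (by omega)

theorem prime_mul_prod_mem (hm : p = 2 * m + 1) (hp4 : p % 4 = 3) :
    (p : ℚ) * ∏ j ∈ Finset.range m, ((4 * j + 3) / (4 * j + 5) : ℚ) ∈ padicIdeal p 2 := by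
  have hunit : ∀ j ∈ Finset.range m, padicNorm p (4 * j + 5) = 1 := fun j hj => by
    rw [Finset.mem_range] at hj
    have hnot : ¬p ∣ 4 * j + 5 := by
      rintro ⟨c, hc⟩
      have hc2 : c < 2 := by
        by_contra! h
        have := Nat.mul_le_mul_left p h
        omega
      interval_cases c <;> omega
    exact_mod_cast (padicNorm.nat_eq_one_iff (p := p) (4 * j + 5)).2 hnot
  have hj : p / 4 ∈ Finset.range m := Finset.mem_range.2 (by omega)
  have hnum : (4 * (p / 4 : ℕ) + 3 : ℚ) = p := by
    exact_mod_cast show 4 * (p / 4) + 3 = p by omega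
  rw [← Finset.mul_prod_erase _ _ hj, hnum]
  refine padicIdeal.mul_mem (e := 1) (f := 1) padicIdeal.self_mem (padicIdeal.mul_mem_right
    (padicIdeal.div_mem padicIdeal.self_mem (hunit _ hj)) (padicIdeal.prod_mem fun j hj => ?_))
  refine padicIdeal.div_mem ?_ (hunit j (Finset.mem_of_mem_erase hj))
  exact_mod_cast padicIdeal.natCast_mem (p := p) (4 * j + 3)

theorem sum_halfRatio_zero_cube_mem (hm : p = 2 * m + 1) (hp4 : p % 4 = 3) :
    ∑ b ∈ Finset.range (m + 1), halfRatio (0 : ℚ) b ^ 3 ∈ padicIdeal p 2 := by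
  have hpm : (2 * m + 1 : ℚ) = p := by exact_mod_cast hm.symm
  have hdixon : ∑ b ∈ Finset.range (m + 1), dixonTerm (p : ℚ) b ∈ padicIdeal p 2 := by
    rw [← hpm, sum_dixonTerm_odd, hpm]
    exact prime_mul_prod_mem hm hp4
  have hcompare : ∑ b ∈ Finset.range (m + 1), halfRatio (0 : ℚ) b ^ 3 *
      (dixonCorrection (p : ℚ) b - 1) ∈ padicIdeal p 2 := by
    refine sum_mem fun b hb => ?_
    rw [Finset.mem_range] at hb
    refine padicIdeal.mul_mem_left ?_ ?_
    · exact padicIdeal.pow_mem (e := 0) (halfRatio_mem (by omega) (zero_mem _) (by omega)) 3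
    · simpa using dixonCorrection_prime_pow_sub_one_mem (p := p) (k := b) (r := 1) (by
        rw [pow_one]
        omega)
  convert sub_mem hdixon hcompare using 1
  rw [← Finset.sum_sub_distrib]
  refine Finset.sum_congr rfl fun b _ => ?_
  rw [dixonTerm_eq_cube_mul_dixonCorrection]
  ring

theorem sum_halfRatio_neg_prime_cube_mem (hm : p = 2 * m + 1) (hp4 : p % 4 = 3) :
    ∑ b ∈ Finset.range (m + 1), halfRatio (-p : ℚ) b ^ 3 ∈ padicIdeal p 2 := by
  have hint : halfRatio (-p : ℚ) m ∈ padicIdeal p 0 :=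
    halfRatio_mem (by omega) (neg_mem padicIdeal.self_mem) (by omega)
  have hpm : (p : ℚ) = 2 * m + 1 := by exact_mod_cast hm
  rw [hpm, sum_halfRatio_neg_pow, ← hpm]
  exact padicIdeal.mul_mem_left (padicIdeal.pow_mem hint 3) (sum_halfRatio_zero_cube_mem hm hp4)

theorem sum_halfRatio_cube_mem (hm : p = 2 * m + 1) (hp4 : p % 4 = 3) {w : ℚ}
    (hw : w ∈ padicIdeal p 1) :
    ∑ b ∈ Finset.range (m + 1), halfRatio w b ^ 3 ∈ padicIdeal p 2 := by
  have haffine : ∑ b ∈ Finset.range (m + 1), (halfRatio · b : ℚ → ℚ) ^ 3 ∈ affineModSq p :=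
    sum_mem fun b hb => pow_mem (halfRatio_mem_affineModSq (by omega)
      (by rw [Finset.mem_range] at hb; omega)) 3
  have hnorm : padicNorm p (-p) = (p : ℚ) ^ (-((1 : ℕ) : ℤ)) := by simp
  simpa using affineModSq.apply_mem haffine hnorm
    (by simpa using sum_halfRatio_zero_cube_mem hm hp4)
    (by simpa using sum_halfRatio_neg_prime_cube_mem hm hp4) hw

theorem halfRatio_zero_mem_of_centralBinom_mem (hp2 : p ≠ 2) {k e : ℕ}
    (h : (k.centralBinom : ℚ) ∈ padicIdeal p e) : halfRatio (0 : ℚ) k ∈ padicIdeal p e := by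
  have hfour : ¬p ∣ 4 ^ k := fun h => hp2 <|
    (Nat.prime_dvd_prime_iff_eq Fact.out Nat.prime_two).1 <|
      Nat.Prime.dvd_of_dvd_pow Fact.out (show p ∣ 2 ^ (2 * k) by rwa [pow_mul])
  rw [halfRatio_zero_eq_centralBinom_div]
  exact padicIdeal.div_mem h (by exact_mod_cast (padicNorm.nat_eq_one_iff (p := p) (4 ^ k)).2 hfour)

theorem halfRatio_zero_mem (hp2 : p ≠ 2) (k : ℕ) : halfRatio (0 : ℚ) k ∈ padicIdeal p 0 :=
  halfRatio_zero_mem_of_centralBinom_mem hp2 (padicIdeal.natCast_mem _)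

theorem prime_dvd_centralBinom_mul {a : ℕ} (ha : a < p) (hpa : p ≤ 2 * a) :
    p ∣ (a * p).centralBinom := by
  have hmod : (a * p).centralBinom ≡ a.centralBinom [MOD p] := by
    rw [Nat.centralBinom, Nat.centralBinom, mul_comm a p, mul_left_comm]
    exact Choose.choose_mul_mul_modEq_choose_nat
  rw [hmod.dvd_iff dvd_rfl, Nat.centralBinom, two_mul]
  exact Nat.Prime.dvd_choose_add Fact.out ha ha (by omega)

theorem halfRatio_zero_mul_mem (hp2 : p ≠ 2) {a : ℕ} (ha : a < p) (hpa : p ≤ 2 * a) :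
    halfRatio (0 : ℚ) (a * p) ∈ padicIdeal p 1 :=
  halfRatio_zero_mem_of_centralBinom_mem hp2
    (padicIdeal.natCast_mem_of_dvd (prime_dvd_centralBinom_mul ha hpa))

theorem two_mul_mul_mem (a : ℕ) : (2 * (a * p : ℕ) : ℚ) ∈ padicIdeal p 1 := by
  exact_mod_cast padicIdeal.natCast_mem_of_dvd (p := p) (n := 2 * (a * p)) ⟨2 * a, by ring⟩

theorem sum_halfRatio_zero_block_cube_mem (hm : p = 2 * m + 1) (hp4 : p % 4 = 3) {a e : ℕ}
    (ha : halfRatio (0 : ℚ) (a * p) ∈ padicIdeal p e) :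
    ∑ b ∈ Finset.range (m + 1), halfRatio (0 : ℚ) (a * p + b) ^ 3 ∈ padicIdeal p (3 * e + 2) := by
  simp only [halfRatio_zero_add, mul_pow, ← Finset.mul_sum]
  exact padicIdeal.mul_mem (e := 3 * e) (f := 2) (padicIdeal.pow_mem ha 3)
    (sum_halfRatio_cube_mem hm hp4 (two_mul_mul_mem a))

theorem halfRatio_zero_mul_add_cube_mem (hm : p = 2 * m + 1) {a b e f : ℕ}
    (ha : halfRatio (0 : ℚ) (a * p) ∈ padicIdeal p e)
    (hf : (p + 2 * (a * p : ℕ) : ℚ) ∈ padicIdeal p f) (hmb : m < b) (hb : b < p) :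
    halfRatio (0 : ℚ) (a * p + b) ^ 3 ∈ padicIdeal p (3 * (e + f)) := by
  rw [halfRatio_zero_add]
  exact padicIdeal.pow_mem (e := e + f) (padicIdeal.mul_mem ha
    (halfRatio_mem_of_add_mem hm (two_mul_mul_mem a) hf hmb hb)) 3

theorem prime_add_two_mul_mul_mem (a : ℕ) : (p + 2 * (a * p : ℕ) : ℚ) ∈ padicIdeal p 1 :=
  add_mem padicIdeal.self_mem (two_mul_mul_mem a)

theorem dixonCorrection_sq_mul_add_sub_mem (hm : p = 2 * m + 1) {a b : ℕ} (ha : a ≤ m)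
    (hb : b ≤ m) : dixonCorrection ((p : ℚ) ^ 2) (a * p + b) -
      dixonCorrection ((p : ℚ) ^ 2) (a * p) ∈ padicIdeal p 4 := by
  have hsq : ∀ u : ℚ, padicNorm p u = 1 →
      ((p : ℚ) ^ 2 / (u + 2 * (a * p : ℕ))) ^ 2 ∈ padicIdeal p 4 := fun u hu =>
    padicIdeal.pow_mem (e := 2) (padicIdeal.div_mem padicIdeal.self_pow_mem
      (padicIdeal.norm_add_eq_one hu (two_mul_mul_mem a))) 2
  have hblock : ∏ j ∈ Finset.range b, (1 - ((p : ℚ) ^ 2 / (2 * (a * p + j : ℕ) + 1)) ^ 2) /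
      (1 - ((p : ℚ) ^ 2 / (2 * (a * p + j : ℕ) + 2)) ^ 2) - 1 ∈ padicIdeal p 4 := by
    refine padicIdeal.prod_sub_one_mem fun j hj => ?_
    rw [Finset.mem_range] at hj
    rw [Nat.cast_add, mul_add, add_assoc, add_assoc, add_comm (2 * ((a * p : ℕ) : ℚ)),
      add_comm (2 * ((a * p : ℕ) : ℚ))]
    exact padicIdeal.one_sub_div_one_sub_sub_one_mem four_ne_zero
      (hsq _ (padicNorm_two_mul_add_one (by omega)))
      (hsq _ (padicNorm_two_mul_add_two (by omega) (by omega)))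
  have hint : dixonCorrection ((p : ℚ) ^ 2) (a * p) ∈ padicIdeal p 0 := by
    rw [← sub_add_cancel (dixonCorrection _ _) 1]
    exact add_mem (padicIdeal.antitone zero_le_two
      (dixonCorrection_prime_pow_sub_one_mem (two_mul_mul_lt_sq (by omega))))
      (SetLike.one_mem_graded _)
  convert padicIdeal.mul_mem_left hint hblock using 1
  rw [dixonCorrection, dixonCorrection, Finset.prod_range_add]
  ring

theorem sum_cube_sub_dixonTerm_block_mem (hm : p = 2 * m + 1) (hp4 : p % 4 = 3) {a : ℕ}
    (ha : a ≤ m) : ∑ b ∈ Finset.range (m + 1), (halfRatio (0 : ℚ) (a * p + b) ^ 3 -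
      dixonTerm ((p : ℚ) ^ 2) (a * p + b)) ∈ padicIdeal p 4 := by
  have hint := halfRatio_zero_mem (p := p) (by omega)
  have hvary : ∑ b ∈ Finset.range (m + 1), halfRatio (0 : ℚ) (a * p + b) ^ 3 *
      (dixonCorrection ((p : ℚ) ^ 2) (a * p + b) - dixonCorrection ((p : ℚ) ^ 2) (a * p)) ∈
        padicIdeal p 4 := by
    refine sum_mem fun b hb => padicIdeal.mul_mem_left
      (padicIdeal.pow_mem (e := 0) (hint _) 3)
      (dixonCorrection_sq_mul_add_sub_mem hm ha ?_)
    rw [Finset.mem_range] at hb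
    omega
  have hfixed : (∑ b ∈ Finset.range (m + 1), halfRatio (0 : ℚ) (a * p + b) ^ 3) *
      (dixonCorrection ((p : ℚ) ^ 2) (a * p) - 1) ∈ padicIdeal p 4 :=
    padicIdeal.mul_mem (e := 2) (f := 2)
      (sum_halfRatio_zero_block_cube_mem (e := 0) hm hp4 (hint _))
      (dixonCorrection_prime_pow_sub_one_mem (two_mul_mul_lt_sq (by omega)))
  convert neg_mem (add_mem hvary hfixed) using 1
  rw [Finset.sum_mul, ← Finset.sum_add_distrib, ← Finset.sum_neg_distrib]
  refine Finset.sum_congr rfl fun b _ => ?_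
  rw [dixonTerm_eq_cube_mul_dixonCorrection]
  ring

theorem cube_sub_dixonTerm_mem (hm : p = 2 * m + 1) {a b : ℕ} (ha : a < m) (hmb : m < b)
    (hb : b < p) : halfRatio (0 : ℚ) (a * p + b) ^ 3 - dixonTerm ((p : ℚ) ^ 2) (a * p + b) ∈
      padicIdeal p 4 := by
  have hlt : 2 * (a * p + b) < p ^ 2 := by
    have := Nat.mul_le_mul_right p (Nat.succ_le_of_lt ha)
    nlinarith
  have hcube := halfRatio_zero_mul_add_cube_mem (e := 0) (f := 1) hm
    (halfRatio_zero_mem (by omega) _) (prime_add_two_mul_mul_mem a) hmb hb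
  have hprod := padicIdeal.mul_mem hcube (dixonCorrection_prime_pow_sub_one_mem hlt)
  convert neg_mem (padicIdeal.antitone (show 4 ≤ 3 * (0 + 1) + 2 by norm_num) hprod) using 1
  rw [dixonTerm_eq_cube_mul_dixonCorrection]
  ring

theorem sum_halfRatio_zero_cube_sub_prod_mem (hm : p = 2 * m + 1) (hp4 : p % 4 = 3) :
    ∑ k ∈ Finset.range (m * p + m + 1), halfRatio (0 : ℚ) k ^ 3 -
      (p : ℚ) ^ 2 * ∏ j ∈ Finset.range (m * p + m), ((4 * j + 3) / (4 * j + 5) : ℚ) ∈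
        padicIdeal p 4 := by
  have hsq : 2 * ((m * p + m : ℕ) : ℚ) + 1 = (p : ℚ) ^ 2 := by
    rw [hm]
    push_cast
    ring
  rw [← hsq, ← sum_dixonTerm_odd, hsq, ← Finset.sum_sub_distrib, add_assoc, Finset.sum_range_add]
  exact add_mem (sum_range_mul_mem_of_blocks (by omega)
    (fun a ha => sum_cube_sub_dixonTerm_block_mem hm hp4 ha.le)
    fun a ha b hmb hb => cube_sub_dixonTerm_mem hm ha hmb hb)
    (sum_cube_sub_dixonTerm_block_mem hm hp4 le_rfl)

theorem sum_halfRatio_zero_middle_block_cube_mem (hm : p = 2 * m + 1) :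
    ∑ b ∈ Finset.range m, halfRatio (0 : ℚ) (m * p + (m + 1 + b)) ^ 3 ∈ padicIdeal p 4 := by
  have hsq : (p + 2 * (m * p : ℕ) : ℚ) ∈ padicIdeal p 2 := by
    rw [show (p + 2 * (m * p : ℕ) : ℚ) = (p : ℚ) ^ 2 by rw [hm]; push_cast; ring]
    exact padicIdeal.self_pow_mem
  refine sum_mem fun b hb => ?_
  rw [Finset.mem_range] at hb
  exact padicIdeal.antitone (show 4 ≤ 3 * (0 + 2) by norm_num)
    (halfRatio_zero_mul_add_cube_mem (e := 0) (f := 2) hm (halfRatio_zero_mem (by omega) _) hsq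
      (by omega) (by omega))

theorem sum_halfRatio_zero_upper_blocks_cube_mem (hm : p = 2 * m + 1) (hp4 : p % 4 = 3) :
    ∑ k ∈ Finset.range (m * p), halfRatio (0 : ℚ) ((m + 1) * p + k) ^ 3 ∈ padicIdeal p 4 := by
  have hblock : ∀ a b, (m + 1) * p + (a * p + b) = (m + 1 + a) * p + b := fun a b => by ring
  have hcarry : ∀ a < m, halfRatio (0 : ℚ) ((m + 1 + a) * p) ∈ padicIdeal p 1 := fun a ha =>
    halfRatio_zero_mul_mem (by omega) (by omega) (by omega)
  refine sum_range_mul_mem_of_blocks (l := m + 1) (by omega) (fun a ha => ?_)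
    fun a ha b hmb hb => ?_
  · simp only [hblock]
    exact padicIdeal.antitone (show 4 ≤ 3 * 1 + 2 by norm_num)
      (sum_halfRatio_zero_block_cube_mem hm hp4 (hcarry a ha))
  · rw [hblock]
    exact padicIdeal.antitone (show 4 ≤ 3 * (1 + 1) by norm_num)
      (halfRatio_zero_mul_add_cube_mem hm (hcarry a ha) (prime_add_two_mul_mul_mem _) hmb hb)

theorem sum_halfRatio_zero_cube_tail_mem (hm : p = 2 * m + 1) (hp4 : p % 4 = 3) :
    ∑ k ∈ Finset.range (p * p), halfRatio (0 : ℚ) k ^ 3 -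
      ∑ k ∈ Finset.range (m * p + m + 1), halfRatio (0 : ℚ) k ^ 3 ∈ padicIdeal p 4 := by
  have hlen : m * p + m + 1 + m = (m + 1) * p := by
    rw [hm]
    ring
  have hpp : p * p = m * p + m + 1 + m + m * p := by
    rw [hlen, ← add_mul]
    congr 1
    omega
  rw [hpp, Finset.sum_range_add, Finset.sum_range_add _ _ m, add_assoc, add_sub_cancel_left, hlen]
  simp only [add_assoc (m * p)]
  exact add_mem (sum_halfRatio_zero_middle_block_cube_mem hm)
    (sum_halfRatio_zero_upper_blocks_cube_mem hm hp4)

end Residue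

theorem risingFactorial_div_risingFactorial (a b : ℚ) (n : ℕ) :
    risingFactorial a n / risingFactorial b n = ∏ j ∈ Finset.range n, (a + j) / (b + j) := by
  simp only [risingFactorial]
  induction n with
  | zero => simp
  | succ n ih => rw [Finset.prod_range_succ, ← ih, ascPochhammer_succ_eval, ascPochhammer_succ_eval,
      mul_div_mul_comm]

theorem risingFactorial_half_div_factorial (k : ℕ) :
    risingFactorial (1 / 2) k / (k.factorial : ℚ) = halfRatio 0 k := by
  have hone : (k.factorial : ℚ) = risingFactorial 1 k := (ascPochhammer_eval_one ℚ k).symm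
  rw [hone, risingFactorial_div_risingFactorial, halfRatio]
  refine Finset.prod_congr rfl fun j _ => ?_
  rw [← mul_div_mul_left _ _ (two_ne_zero' ℚ)]
  congr 1 <;> ring

theorem risingFactorial_three_quarters_div (n : ℕ) :
    risingFactorial (3 / 4) n / risingFactorial (5 / 4) n =
      ∏ j ∈ Finset.range n, ((4 * j + 3) / (4 * j + 5) : ℚ) := by
  rw [risingFactorial_div_risingFactorial]
  refine Finset.prod_congr rfl fun j _ => ?_
  rw [← mul_div_mul_left _ _ (four_ne_zero' ℚ)]
  congr 1 <;> ring

theorem mainTheorem3 (p : ℕ) (hp : p.Prime) (hp4 : p % 4 = 3) :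
    RatModEq (p ^ 4)
      (∑ k ∈ Finset.Icc 0 ((p ^ 2 - 1) / 2),
        risingFactorial (1 / 2) k ^ 3 / (k.factorial : ℚ) ^ 3)
      ((p : ℚ) ^ 2 * (risingFactorial (3 / 4) ((p ^ 2 - 1) / 2) /
        risingFactorial (5 / 4) ((p ^ 2 - 1) / 2))) ∧
    RatModEq (p ^ 4)
      (∑ k ∈ Finset.Icc 0 (p ^ 2 - 1),
        risingFactorial (1 / 2) k ^ 3 / (k.factorial : ℚ) ^ 3)
      ((p : ℚ) ^ 2 * (risingFactorial (3 / 4) ((p ^ 2 - 1) / 2) /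
        risingFactorial (5 / 4) ((p ^ 2 - 1) / 2))) := by
  have : Fact p.Prime := ⟨hp⟩
  obtain ⟨m, hm⟩ : ∃ m, p = 2 * m + 1 := ⟨p / 2, by omega⟩
  have hsq : p * p = 2 * (m * p + m) + 1 := by
    rw [hm]
    ring
  have hhalf : (p ^ 2 - 1) / 2 = m * p + m := by
    rw [sq]
    omega
  have hlen : p ^ 2 - 1 + 1 = p * p := by
    rw [sq]
    omega
  simp only [← Nat.range_succ_eq_Icc_zero, hhalf, hlen, ← div_pow,
    risingFactorial_half_div_factorial, risingFactorial_three_quarters_div]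
  have htrunc := sum_halfRatio_zero_cube_sub_prod_mem hm hp4
  have htail := sum_halfRatio_zero_cube_tail_mem hm hp4
  exact ⟨padicIdeal.ratModEq_of_sub_mem htrunc, padicIdeal.ratModEq_of_sub_mem
    (by simpa only [sub_add_sub_cancel] using add_mem htail htrunc)⟩
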